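/- Devices. A *cellular automaton transducer* (CAT) with input alphabet $A$ and output alphabet $B$ has a finite state set $S\supseteq A$, accepting states $F\subseteq S$, a boundary symbol $\#\notin S$ and a local function $\delta:(S\cup\{\#\})\times S\times(S\cup\{\#\})\to S\times(B^*\cup\{\bot\})$. On input $w=a_1\cdots a_n\in A^+$ it consists of $n$ synchronous cells; cell $i$ starts in state $a_i$ with empty output register $\bot$, and in every step changes its state by $\delta$ according to its own state and the states of its two neighbors ($\#$ outside the array), and fills its output register by $\delta$ if it is still empty. The input is accepted if the leftmost cell is in an accepting state at some time. $M$ transforms $w$ into $v$ if $w$ is accepted and eventually all output registers are filled and contain, from left to right, words whose concatenation is $v$. An *iterative array transducer* (IAT) is an array of cells $0,1,2,\dots$ with a finite state set $S$, all initially in a quiescent state $s_0$. The cells $i\ge 1$ change state by $\delta:S^3\to S$, with $\delta(s_0,s_0,s_0)=s_0$, according to themselves and their two neighbors. In each step the communication cell $0$ reads the next input symbol (an end-of-input symbol $\triangleleft$ after the input) and, by a partial function $\delta_0:(A\cup\{\triangleleft\})\times S^2\to B^*\times S$ of that symbol, its own state and the state of cell $1$, appends a word to the output and changes its state; the array halts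 when $\delta_0$ is undefined. The input is accepted if cell $0$ is in an accepting state at some time of the computation. $M$ transforms $w$ into $v$ if $w$ is accepted, the array halts, and $v$ is the total output. An *iterative array* is such a device without output, considered as an acceptor. For both kinds of transducers $T(M)$ is the set of pairs $(w,v)\in A^+\times B^*$ such that $M$ transforms $w$ into $v$. As usual for devices in which acceptance determines the domain, the transducers considered are those whose accepted nonempty inputs are exactly those that they transform, so that the projection of $T(M)$ on the first components is the language accepted by $M$. $M$ has time complexity $(t_i,t_o)$ if for every $(w,v)\in T(M)$ the input $w$ is accepted after at most $t_i(|w|)$ steps and the whole output $v$ has been emitted after at most $t_o(|w|)$ steps. $\mathscr{T}(\mathrm{CAT}_{t_i,t_o})$ and $\mathscr{T}(\mathrm{IAT}_{t_i,t_o})$ are the families of the transductions $T(M)$ of such $M$ with time complexity $(t_i,t_o)$. Real time ($rt$) is $n$ for CAT and $n+1$ for iterative arrays and IAT. Languages are compared up to the empty word. **Theorem.** Let $$L=\{\,\& x_k \& \cdots\& x_1 \$ y_1\& \cdots\& y_k\& \mid k\geq 1,\ x_i,y_i,z_i\in\{a,b\}^*,\ x_i^R=y_iz_i \text{ for } 1\le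 i\le k\,\}.$$ Then $L$ is a linear context-free language that is not accepted by any real-time iterative array, and for every $t_o:\mathbb{N}\to\mathbb{N}$ with $t_o(n)\ge n$ for all $n$, the transduction $\{\,(w,a^{|w|}) \mid w\in L\,\}$ belongs to $\mathscr{T}(\mathrm{CAT}_{rt,rt})$ but not to $\mathscr{T}(\mathrm{IAT}_{rt,t_o})$. -/

import Mathlib

/-- A cellular automaton transducer with input alphabet `A` and output alphabet `B`.
The boundary symbol `#` is `none : Option State`; the symbol `⊥` (no output) is
`none : Option (List B)`.  The inclusion of `A` in the state set is the injection `input`. -/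
structure CAT (A B : Type) where
  State : Type
  finite_state : Finite State
  F : Set State
  input : A ↪ State
  δ : Option State → State → Option State → State × Option (List B)

namespace CAT

variable {A B : Type}

/-- Configurations on `n` cells. The cells are numbered `0, …, n - 1`. -/
structure Config (M : CAT A B) (n : ℕ) where
  cell : Fin n → M.State
  out : Fin n → Option (List B)

variable (M : CAT A B)

/-- The state visible to the cell `i` on its left input line. -/
def left {n : ℕ} (c : Fin n → M.State) (i : Fin n) : Option M.State :=
  if i.val = 0 then none else some (c ⟨i.val - 1, by have := i.isLt; omega⟩)

/-- The state visible to the cell `i` on its right input line. -/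
def right {n : ℕ} (c : Fin n → M.State) (i : Fin n) : Option M.State :=
  if h : i.val + 1 < n then some (c ⟨i.val + 1, h⟩) else none

/-- The global transition function; an output register is filled at most once. -/
def step {n : ℕ} (c : M.Config n) : M.Config n where
  cell := fun i => (M.δ (M.left c.cell i) (c.cell i) (M.right c.cell i)).1
  out := fun i =>
    match c.out i with
    | some v => some v
    | none => (M.δ (M.left c.cell i) (c.cell i) (M.right c.cell i)).2

/-- The initial configuration for the input `w`. -/
def init (w : List A) : M.Config w.length where
  cell := fun i => M.input (w.get i)
  out := fun _ => none

/-- The configuration at time `t` on input `w`. -/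
def config (w : List A) : ℕ → M.Config w.length
  | 0 => M.init w
  | t + 1 => M.step (config w t)

/-- At time `t` the leftmost cell is in an accepting state. -/
def AcceptsAt (w : List A) (t : ℕ) : Prop :=
  ∃ h : 0 < w.length, (M.config w t).cell ⟨0, h⟩ ∈ M.F

def Accepts (w : List A) : Prop := ∃ t, M.AcceptsAt w t

/-- At time `t` every cell has emitted its output, and the outputs concatenate to `v`. -/
def EmittedAt (w : List A) (v : List B) (t : ℕ) : Prop :=
  ∃ u : Fin w.length → List B,
    (∀ i, (M.config w t).out i = some (u i)) ∧ v = (List.ofFn u).flatten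

/-- The transduction realized by `M`, a subset of `A⁺ × B*`. -/
def transduction : Set (List A × List B) :=
  {p | p.1 ≠ [] ∧ M.Accepts p.1 ∧ ∃ t, M.EmittedAt p.1 p.2 t}

/-- `M` accepts exactly the inputs that it transforms: the projection of the transduction on
the first components is the language of `M` as an acceptor. -/
def DomainIsAccepted : Prop :=
  ∀ w : List A, w ≠ [] → (M.Accepts w ↔ ∃ v, (w, v) ∈ M.transduction)

/-- `M` has time complexity `(tin, tout)`. -/
def HasTime (tin tout : ℕ → ℕ) : Prop :=
  ∀ w v, (w, v) ∈ M.transduction →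
    (∃ t ≤ tin w.length, M.AcceptsAt w t) ∧ (∃ t ≤ tout w.length, M.EmittedAt w v t)

/-- The family of the transductions from `A⁺` to `B*` realized by cellular automaton
transducers of time complexity `(tin, tout)`. -/
def family (A B : Type) [Finite A] [Nonempty A] [Finite B] (tin tout : ℕ → ℕ) :
    Set (Set (List A × List B)) :=
  {T | ∃ M : CAT A B, M.DomainIsAccepted ∧ M.HasTime tin tout ∧ M.transduction = T}

end CAT

/-- An iterative array transducer with input alphabet `A` and output alphabet `B`.
The end-of-input symbol is `none : Option A`; the local transition function `δ₀` of the
communication cell is partial (`none` where it is undefined).  Its arguments are the input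
symbol, the state of the communication cell and the state of its right neighbor. -/
structure IAT (A B : Type) where
  State : Type
  finite_state : Finite State
  F : Set State
  s₀ : State
  δ : State → State → State → State
  δ_quiescent : δ s₀ s₀ s₀ = s₀
  δ₀ : Option A → State → State → Option (List B × State)

namespace IAT

variable {A B : Type}

/-- Configurations: the states of the cells `0, 1, 2, …`, where the cell `0` is the
communication cell, and the output emitted so far. -/
structure Config (M : IAT A B) where
  cell : ℕ → M.State
  out : List B

variable (M : IAT A B)

/-- One step with current input symbol `x`; `none` if the array halts instead. -/
def step (x : Option A) (c : M.Config) : Option M.Config :=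
  (M.δ₀ x (c.cell 0) (c.cell 1)).map fun r =>
    { cell := fun i =>
        match i with
        | 0 => r.2
        | i + 1 => M.δ (c.cell i) (c.cell (i + 1)) (c.cell (i + 2))
      out := c.out ++ r.1 }

/-- The configuration at time `t` on input `w`, or `none` if the array has halted before.
At time `t` the symbol with (zero-based) position `t` of the input is read, and the
end-of-input symbol if there is none. -/
def config (w : List A) : ℕ → Option M.Config
  | 0 => some { cell := fun _ => M.s₀, out := [] }
  | t + 1 => (config w t).bind (M.step w[t]?)

/-- At time `t` of the computation the communication cell is in an accepting state. -/
def AcceptsAt (w : List A) (t : ℕ) : Prop :=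
  ∃ c, M.config w t = some c ∧ c.cell 0 ∈ M.F

def Accepts (w : List A) : Prop := ∃ t, M.AcceptsAt w t

/-- At time `t` of the computation the output emitted so far is `v`. -/
def EmittedAt (w : List A) (v : List B) (t : ℕ) : Prop :=
  ∃ c, M.config w t = some c ∧ c.out = v

/-- The computation on input `w` halts at time `t`. -/
def HaltsAt (w : List A) (t : ℕ) : Prop :=
  (M.config w t).isSome ∧ M.config w (t + 1) = none

/-- The transduction computed by `M`, restricted to nonempty inputs. -/
def transduction : Set (List A × List B) :=
  {p | p.1 ≠ [] ∧ M.Accepts p.1 ∧ ∃ t, M.HaltsAt p.1 t ∧ M.EmittedAt p.1 p.2 t}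

/-- `M` accepts exactly the inputs that it transforms: the projection of the transduction on
the first components is the language of `M` as an acceptor. -/
def DomainIsAccepted : Prop :=
  ∀ w : List A, w ≠ [] → (M.Accepts w ↔ ∃ v, (w, v) ∈ M.transduction)

/-- `M` has time complexity `(tin, tout)`: inputs are accepted in time `tin`, and the total
output has been emitted in time `tout`. -/
def HasTime (tin tout : ℕ → ℕ) : Prop :=
  ∀ w v, (w, v) ∈ M.transduction →
    (∃ t ≤ tin w.length, M.AcceptsAt w t) ∧ (∃ t ≤ tout w.length, M.EmittedAt w v t)

/-- The family of the transductions from `A⁺` to `B*` computed by iterative array transducers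
of time complexity `(tin, tout)`. -/
def family (A B : Type) [Finite A] [Finite B] (tin tout : ℕ → ℕ) :
    Set (Set (List A × List B)) :=
  {T | ∃ M : IAT A B, M.DomainIsAccepted ∧ M.HasTime tin tout ∧ M.transduction = T}

end IAT

/-- An iterative array (acceptor) is an iterative array without output: its output alphabet
is empty, so that the empty word is the only possible output. -/
abbrev IA (A : Type) := IAT A Empty

/-- `L` is accepted by some iterative array in time `tin`, up to the empty word. -/
def AcceptedByIA {A : Type} [Finite A] (tin : ℕ → ℕ) (L : Language A) : Prop :=
  ∃ M : IA A, ∀ w : List A, w ≠ [] →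
    ((M.Accepts w ↔ w ∈ L) ∧ (M.Accepts w → ∃ t ≤ tin w.length, M.AcceptsAt w t))

/-- Real time for cellular automaton transducers. -/
def rtCAT (n : ℕ) : ℕ := n

/-- Real time for iterative arrays and iterative array transducers. -/
def rtIA (n : ℕ) : ℕ := n + 1

/-- Linear context-free languages: generated by a context-free grammar in which every
right-hand side contains at most one nonterminal. -/
def IsLinearContextFree {A : Type} (L : Language A) : Prop :=
  ∃ g : ContextFreeGrammar.{0} A,
    (∀ r ∈ g.rules, ∀ (α β γ : List (Symbol A g.NT)) (X Y : g.NT),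
      r.output ≠ α ++ [Symbol.nonterminal X] ++ β ++ [Symbol.nonterminal Y] ++ γ) ∧
    g.language = L

/-- The alphabet `{a, b, &, $}`. -/
inductive Letter where
  | a
  | b
  | amp
  | dollar
  deriving DecidableEq

instance : Fintype Letter where
  elems := {Letter.a, Letter.b, Letter.amp, Letter.dollar}
  complete := by intro x; cases x <;> decide

instance : Nonempty Letter := ⟨Letter.a⟩

/-- `u` is a word over `{a, b}`. -/
def IsABWord (u : List Letter) : Prop := ∀ s ∈ u, s = Letter.a ∨ s = Letter.b

/-- The language of all words `& x_k & ⋯ & x_1 $ y_1 & ⋯ & y_k &` with `k ≥ 1`, where all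
`x_i, y_i, z_i` are words over `{a, b}` and the reversal of `x_i` is `y_i z_i`.  The index `i`
runs through `0, …, k - 1` here. -/
def witnessLanguage : Language Letter :=
  {w | ∃ (k : ℕ) (x y z : Fin k → List Letter), 1 ≤ k ∧
    (∀ i, IsABWord (x i) ∧ IsABWord (y i) ∧ IsABWord (z i) ∧
      (x i).reverse = y i ++ z i) ∧
    w = (List.ofFn x).reverse.flatMap (fun u => [Letter.amp] ++ u) ++ [Letter.dollar] ++
      (List.ofFn y).flatMap (fun u => u ++ [Letter.amp])}

/-- The transduction that maps every word `w` of `L` to `a^{|w|}`. -/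
def unaryTransduction (L : Language Letter) : Set (List Letter × List Letter) :=
  {p | p.1 ∈ L ∧ p.2 = List.replicate p.1.length Letter.a}

/-! The positive half holds for every linear grammar whose rules generate one terminal each, at the
left or right end. The nonterminals deriving an infix then depend only on its two end letters and on
the nonterminals deriving the infix without its last and without its first letter
(`combine_derives`). In a cellular array, cell `i` holds the second datum and its right neighbor the
third, so infixes grow by one letter per step and cell `0` knows the answer after `n` steps
(`toCAT_cell`). If moreover every cell emits one letter at once, the output is the unary word.
`witnessGrammar` is such a grammar for the language.

The negative half is a counting argument. A block `x_i` can be queried by a suffix whose only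
nonempty block is the `i`-th, so the prefix must preserve all of the `k * k` bits of `k` blocks of
length `k`, while the suffixes have length only `2 * k`. In the time left after the prefix,
information can reach cell `0` only from the first `2 * k + 2` cells, which have only exponentially
many joint states in `k` (`accepts_of_signature_eq`, `not_realTime_witnessLanguage`). Output never
influences the states, so the bound covers transducers and acceptors alike. -/

/-! ### Linear grammars in normal form as context-free grammars -/

/-- A linear grammar in normal form: its rules are `X → c Y`, `X → Y c` and `X → c`. -/
structure LinearGrammar (A : Type) where
  NT : Type
  finite_NT : Finite NT
  start : NT
  left : NT → A → NT → Prop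
  right : NT → NT → A → Prop
  term : NT → A → Prop

namespace LinearGrammar

variable {A B : Type} (G : LinearGrammar A)

/-- `G.Derives X w` means that the nonterminal `X` derives the word `w`. -/
inductive Derives : G.NT → List A → Prop
  | term {X c} : G.term X c → Derives X [c]
  | left {X c Y w} : G.left X c Y → Derives Y w → Derives X (c :: w)
  | right {X Y c w} : G.right X Y c → Derives Y w → Derives X (w ++ [c])

/-- The language generated by a linear grammar in normal form. -/
def lang : Language A := {w | G.Derives G.start w}

variable {G} in
theorem Derives.ne_nil {X : G.NT} {w : List A} (h : G.Derives X w) : w ≠ [] := by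
  cases h <;> simp

/-- The rules of `G` as context-free rules. -/
inductive IsRule : ContextFreeRule A G.NT → Prop
  | term {X c} : G.term X c → IsRule ⟨X, [.terminal c]⟩
  | left {X c Y} : G.left X c Y → IsRule ⟨X, [.terminal c, .nonterminal Y]⟩
  | right {X Y c} : G.right X Y c → IsRule ⟨X, [.nonterminal Y, .terminal c]⟩

theorem finite_rules [Finite A] : {r | G.IsRule r}.Finite := by
  have := G.finite_NT
  refine (((Set.finite_range fun p : G.NT × A =>
      (⟨p.1, [.terminal p.2]⟩ : ContextFreeRule A G.NT)).union
    (Set.finite_range fun p : G.NT × A × G.NT =>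
      (⟨p.1, [.terminal p.2.1, .nonterminal p.2.2]⟩ : ContextFreeRule A G.NT))).union
    (Set.finite_range fun p : G.NT × G.NT × A =>
      (⟨p.1, [.nonterminal p.2.1, .terminal p.2.2]⟩ : ContextFreeRule A G.NT))).subset ?_
  rintro _ (@⟨X, c, h⟩ | @⟨X, c, Y, h⟩ | @⟨X, Y, c, h⟩)
  · exact Or.inl (Or.inl ⟨(X, c), rfl⟩)
  · exact Or.inl (Or.inr ⟨(X, c, Y), rfl⟩)
  · exact Or.inr ⟨(X, Y, c), rfl⟩

/-- The context-free grammar given by a linear grammar in normal form. -/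
noncomputable def toCFG [Finite A] : ContextFreeGrammar.{0} A where
  NT := G.NT
  initial := G.start
  rules := G.finite_rules.toFinset

theorem mem_rules_toCFG [Finite A] {r : ContextFreeRule A G.NT} :
    r ∈ G.toCFG.rules ↔ G.IsRule r := by
  exact G.finite_rules.mem_toFinset

/-- The language of the terminal words derived from a symbol. -/
def symbolLang : Symbol A G.NT → Language A
  | .terminal c => {[c]}
  | .nonterminal X => {w | G.Derives X w}

/-- The language of the terminal words derived from a sentential form. -/
def formLang (s : List (Symbol A G.NT)) : Language A := (s.map G.symbolLang).prod

variable {G} in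
theorem IsRule.formLang_le {r : ContextFreeRule A G.NT} (h : G.IsRule r) :
    G.formLang r.output ≤ G.symbolLang (.nonterminal r.input) := by
  intro w hw
  cases h with
  | term h =>
    simp only [formLang, List.map_cons, List.map_nil, List.prod_cons, List.prod_nil, mul_one] at hw
    obtain rfl : w = _ := hw
    exact .term h
  | left h =>
    simp only [formLang, List.map_cons, List.map_nil, List.prod_cons, List.prod_nil, mul_one] at hw
    obtain ⟨u, rfl, v, hv, rfl⟩ := Language.mem_mul.1 hw
    exact .left h hv
  | right h =>
    simp only [formLang, List.map_cons, List.map_nil, List.prod_cons, List.prod_nil, mul_one] at hw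
    obtain ⟨u, hu, v, rfl, rfl⟩ := Language.mem_mul.1 hw
    exact .right h hu

/-- Concatenation of languages is monotone, so replacing a nonterminal by the right-hand side of one
of its rules can only shrink the language of a sentential form. Applied to a derivation of a
terminal word from the start symbol, this puts the word into `G.lang`. -/
theorem formLang_le_of_derives [Finite A] {s t : List (Symbol A G.NT)}
    (h : G.toCFG.Derives s t) : G.formLang t ≤ G.formLang s := by
  induction h with
  | refl => exact le_rfl
  | tail _ hp ih =>
    refine le_trans ?_ ih
    obtain ⟨r, hr, hrw⟩ := hp
    obtain ⟨p, q, rfl, rfl⟩ := hrw.exists_parts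
    have key : ∀ (p q : List (Symbol A G.NT)) (r : ContextFreeRule A G.NT), G.IsRule r →
        G.formLang (p ++ r.output ++ q) ≤ G.formLang (p ++ [.nonterminal r.input] ++ q) := by
      intro p q r hr
      have := hr.formLang_le
      simp only [formLang, List.map_append, List.prod_append, List.map_cons, List.map_nil,
        List.prod_cons, List.prod_nil, mul_one] at this ⊢
      gcongr
    exact key p q r (G.mem_rules_toCFG.1 hr)

theorem mem_formLang_terminal (w : List A) : w ∈ G.formLang (w.map .terminal) := by
  induction w with
  | nil => simp [formLang]
  | cons c w ih =>
    simp only [formLang, List.map_cons, List.prod_cons] at ih ⊢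
    exact Language.mem_mul.2 ⟨[c], rfl, w, ih, rfl⟩

variable {G} in
theorem Derives.toCFG [Finite A] {X : G.NT} {w : List A} (h : G.Derives X w) :
    G.toCFG.Derives [.nonterminal X] (w.map .terminal) := by
  have key : ∀ r, G.IsRule r → G.toCFG.Derives [.nonterminal r.input] r.output := fun r hr =>
    ContextFreeGrammar.Produces.single
      ⟨r, G.mem_rules_toCFG.2 hr, ContextFreeRule.Rewrites.input_output⟩
  induction h with
  | term h => exact key _ (.term h)
  | left h _ ih => exact (key _ (.left h)).trans (ih.append_left [_])
  | right h _ ih =>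
    rw [List.map_append]
    exact (key _ (.right h)).trans (ih.append_right [_])

theorem language_toCFG [Finite A] : G.toCFG.language = G.lang := by
  ext w
  refine ⟨fun h => ?_, fun h => Derives.toCFG h⟩
  have := G.formLang_le_of_derives h (G.mem_formLang_terminal w)
  have key : G.formLang [.nonterminal G.start] = G.lang := by
    rw [formLang, List.map_singleton, List.prod_singleton]; rfl
  rw [← key]
  exact this

variable {G} in
theorem IsRule.output_ne {r : ContextFreeRule A G.NT} (hr : G.IsRule r)
    (α β γ : List (Symbol A G.NT)) (X Y : G.NT) :
    r.output ≠ α ++ [Symbol.nonterminal X] ++ β ++ [Symbol.nonterminal Y] ++ γ := by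
  intro h
  -- Count nonterminals: at most one on the left, at least two on the right.
  have hc := congrArg (List.countP fun s : Symbol A G.NT =>
    match s with
    | .nonterminal _ => true
    | .terminal _ => false) h
  cases hr <;>
  · simp only [List.countP_append, List.countP_cons, List.countP_nil] at hc
    simp at hc
    try omega

theorem isLinearContextFree [Finite A] : IsLinearContextFree G.lang :=
  ⟨G.toCFG, fun _ hr => (G.mem_rules_toCFG.1 hr).output_ne, G.language_toCFG⟩

/-! ### Real-time recognition by a cellular automaton -/

/-- The nonterminals deriving a word with first letter `c` and last letter `d`, from those that
derive the word without its last letter and without its first letter. -/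
def combine (c d : A) (N N' : Set G.NT) : Set G.NT :=
  {X | ∃ Y, G.left X c Y ∧ Y ∈ N' ∨ G.right X Y d ∧ Y ∈ N}

/-- The first rule of a derivation splits off either the first or the last letter; a terminal rule
is impossible because the word has at least two letters. -/
theorem combine_derives {c d : A} {u v : List A} (h : c :: u = v ++ [d]) (hu : u ≠ []) :
    G.combine c d {X | G.Derives X v} {X | G.Derives X u} = {X | G.Derives X (c :: u)} := by
  ext X
  constructor
  · rintro ⟨Y, ⟨hl, hY⟩ | ⟨hr, hY⟩⟩
    · exact .left hl hY
    · change G.Derives X (c :: u)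
      rw [h]
      exact .right hr hY
  · intro hX
    change G.Derives X (c :: u) at hX
    generalize hw : c :: u = w at hX
    cases hX with
    | term _ => exact absurd (List.cons.inj hw).2 hu
    | left hl hY =>
      obtain ⟨rfl, rfl⟩ := List.cons.inj hw
      exact ⟨_, Or.inl ⟨hl, hY⟩⟩
    | right hr hY =>
      obtain ⟨rfl, hd⟩ := List.append_inj' (h.symm.trans hw) rfl
      obtain rfl := List.singleton_inj.1 hd
      exact ⟨_, Or.inr ⟨hr, hY⟩⟩

open Classical in
/-- The real-time cellular automaton recognizing `G.lang`. The cell `i` at time `t` stores the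
letters `i` and `i + t` and the nonterminals that derive the infix between them; a flag runs in
from the right end of the array. Every cell emits the letter `o` in the first step. -/
noncomputable def toCAT [Finite A] (o : B) : CAT A B where
  State := A × A × Set G.NT × Bool
  finite_state := by
    have := G.finite_NT
    infer_instance
  F := {s | G.start ∈ s.2.2.1 ∧ s.2.2.2 = true}
  input := ⟨fun c => (c, c, {X | G.term X c}, false), fun _ _ h => (Prod.mk.inj h).1⟩
  δ _ s r :=
    (match s.2.2.2, r with
      | true, _ => s
      | false, none => (s.1, s.2.1, s.2.2.1, true)
      | false, some r =>
        if r.2.2.2 = true then (s.1, s.2.1, s.2.2.1, true)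
        else (s.1, r.2.1, G.combine s.1 r.2.1 s.2.2.1 r.2.2.1, false),
      some [o])

theorem derives_singleton {X : G.NT} {c : A} : G.Derives X [c] ↔ G.term X c := by
  refine ⟨fun h => ?_, .term⟩
  generalize hw : [c] = w at h
  cases h with
  | term h => simp_all
  | left _ h => exact absurd (List.cons.inj hw).2.symm h.ne_nil
  | @right _ _ _ v _ h =>
    have := h.ne_nil
    cases v <;> simp_all

/-- The invariant of the computation. The flag reaches cell `i` at time `n - i`, one step after its
infix has become the whole suffix; from then on the cell is frozen. The extra step still lets cell
`0` decide at time `n`. -/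
theorem toCAT_cell [Finite A] (o : B) (w : List A) (t : ℕ) (i : Fin w.length) :
    (∀ h : i.val + t < w.length, ((G.toCAT o).config w t).cell i =
      (w[i.val], w[i.val + t], {X | G.Derives X ((w.drop i).take (t + 1))}, false)) ∧
    (w.length ≤ i.val + t → (((G.toCAT o).config w t).cell i).2.2 =
      ({X | G.Derives X (w.drop i)}, true)) := by
  induction t generalizing i with
  | zero =>
    refine ⟨fun h => ?_, fun h => absurd i.isLt (by omega)⟩
    have : (w.drop i).take 1 = [w[i.val]] := by
      rw [List.drop_eq_getElem_cons i.isLt]; rfl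
    rw [this]
    simp only [derives_singleton]
    rfl
  | succ t ih =>
    have hstep : ((G.toCAT o).config w (t + 1)).cell i =
      ((G.toCAT o).δ ((G.toCAT o).left ((G.toCAT o).config w t).cell i)
        (((G.toCAT o).config w t).cell i)
        ((G.toCAT o).right ((G.toCAT o).config w t).cell i)).1 := rfl
    constructor
    · intro h
      have h1 := (ih i).1 (by omega)
      have h2 := (ih ⟨i.val + 1, by omega⟩).1 (by simp only; omega)
      have hr : (G.toCAT o).right ((G.toCAT o).config w t).cell i =
        some (((G.toCAT o).config w t).cell ⟨i.val + 1, by omega⟩) := by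
        rw [CAT.right, dif_pos]
      rw [hstep, hr, h1, h2]
      have e1 : (w.drop i).take (t + 2) = w[i.val] :: (w.drop (i.val + 1)).take (t + 1) := by
        rw [List.drop_eq_getElem_cons i.isLt]; rfl
      have e2 : (w.drop i).take (t + 2) = (w.drop i).take (t + 1) ++ [w[i.val + (t + 1)]] := by
        rw [List.take_add_one, List.getElem?_drop, List.getElem?_eq_getElem (by omega)]; rfl
      have e3 : (w.drop (i.val + 1)).take (t + 1) ≠ [] := by
        rw [← List.length_pos_iff, List.length_take, List.length_drop]; omega
      have e4 := G.combine_derives (e1.symm.trans e2) e3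
      rw [← e1] at e4
      have e5 : i.val + 1 + t = i.val + (t + 1) := by omega
      simp [toCAT, e5, ← e4]
    · intro h
      -- In the first case `i + t = n - 1`: the flag arrives in this very step, from the right
      -- neighbor or, in the last cell, from the boundary.
      rcases Nat.lt_or_ge (i.val + t) w.length with h' | h'
      · have h1 := (ih i).1 h'
        have e : (w.drop i).take (t + 1) = w.drop i :=
          List.take_of_length_le (by rw [List.length_drop]; omega)
        rw [e] at h1
        rw [hstep, h1]
        by_cases hi : i.val + 1 < w.length
        · have h2 := (ih ⟨i.val + 1, hi⟩).2 (by simp only; omega)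
          have hr : (G.toCAT o).right ((G.toCAT o).config w t).cell i =
            some (((G.toCAT o).config w t).cell ⟨i.val + 1, hi⟩) := by
            rw [CAT.right, dif_pos hi]
          rw [hr]
          simp only [toCAT] at h2 ⊢
          simp [h2]
        · have hr : (G.toCAT o).right ((G.toCAT o).config w t).cell i = none := by
            rw [CAT.right, dif_neg hi]
          rw [hr]
          simp [toCAT]
      · have h1 := (ih i).2 h'
        rw [hstep]
        simp only [toCAT] at h1 ⊢
        simp [h1]

theorem toCAT_acceptsAt [Finite A] (o : B) {w : List A} (hw : w ≠ []) (t : ℕ) :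
    (G.toCAT o).AcceptsAt w t ↔ w.length ≤ t ∧ w ∈ G.lang := by
  have h0 := List.length_pos_iff.2 hw
  have hc := G.toCAT_cell o w t ⟨0, h0⟩
  simp only [Nat.zero_add, List.drop_zero] at hc
  have hF : ∀ s : (G.toCAT o).State, s ∈ (G.toCAT o).F ↔
    G.start ∈ s.2.2.1 ∧ s.2.2.2 = true := fun s => Iff.rfl
  have hA : (G.toCAT o).AcceptsAt w t ↔
      ((G.toCAT o).config w t).cell ⟨0, h0⟩ ∈ (G.toCAT o).F :=
    ⟨fun ⟨_, h⟩ => h, fun h => ⟨h0, h⟩⟩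
  rw [hA, hF]
  rcases Nat.lt_or_ge t w.length with h | h
  · rw [hc.1 h]
    simp only [Bool.false_eq_true, and_false, false_iff]
    omega
  · rw [hc.2 h]
    simp only [and_true, h, true_and]
    rfl

theorem toCAT_accepts [Finite A] (o : B) {w : List A} (hw : w ≠ []) :
    (G.toCAT o).Accepts w ↔ w ∈ G.lang := by
  simp only [CAT.Accepts, G.toCAT_acceptsAt o hw]
  exact ⟨fun ⟨_, _, h⟩ => h, fun h => ⟨_, le_rfl, h⟩⟩

theorem toCAT_out [Finite A] (o : B) (w : List A) (t : ℕ) (i : Fin w.length) :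
    ((G.toCAT o).config w (t + 1)).out i = some [o] := by
  induction t with
  | zero => rfl
  | succ t ih => rw [CAT.config, CAT.step]; simp only [ih]

theorem toCAT_emittedAt [Finite A] (o : B) {w : List A} (hw : w ≠ []) (v : List B) (t : ℕ) :
    (G.toCAT o).EmittedAt w v t ↔ 1 ≤ t ∧ v = List.replicate w.length o := by
  have hflat : (List.ofFn fun _ : Fin w.length => [o]).flatten = List.replicate w.length o := by
    simp [List.ofFn_const]
  constructor
  · rintro ⟨u, hu, rfl⟩
    cases t with
    | zero => exact absurd (hu ⟨0, List.length_pos_iff.2 hw⟩) (by simp [CAT.config, CAT.init])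
    | succ t =>
      have : u = fun _ => [o] := by
        ext1 i
        have := hu i
        rw [toCAT_out] at this
        exact (Option.some.inj this).symm
      rw [this, hflat]
      exact ⟨by omega, rfl⟩
  · rintro ⟨ht, rfl⟩
    obtain ⟨t, rfl⟩ := Nat.exists_eq_add_of_le' ht
    exact ⟨fun _ => [o], fun i => G.toCAT_out o w t i, hflat.symm⟩

theorem mem_transduction_toCAT [Finite A] (o : B) (w : List A) (v : List B) :
    (w, v) ∈ (G.toCAT o).transduction ↔ w ∈ G.lang ∧ v = List.replicate w.length o := by
  constructor
  · rintro ⟨hw, ha, t, ht⟩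
    exact ⟨(G.toCAT_accepts o hw).1 ha, ((G.toCAT_emittedAt o hw _ _).1 ht).2⟩
  · rintro ⟨hL, hv⟩
    have hw : w ≠ [] := Derives.ne_nil hL
    exact ⟨hw, (G.toCAT_accepts o hw).2 hL, 1, (G.toCAT_emittedAt o hw _ _).2 ⟨le_rfl, hv⟩⟩

theorem unary_mem_family [Finite A] [Nonempty A] [Finite B] (o : B) :
    {p : List A × List B | p.1 ∈ G.lang ∧ p.2 = List.replicate p.1.length o} ∈
      CAT.family A B rtCAT rtCAT := by
  refine ⟨G.toCAT o, fun w hw => ?_, fun w v h => ?_, ?_⟩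
  · simp [G.toCAT_accepts o hw, mem_transduction_toCAT]
  · have hw : w ≠ [] := h.1
    have h' := (G.mem_transduction_toCAT o w v).1 h
    exact ⟨⟨w.length, le_rfl, (G.toCAT_acceptsAt o hw _).2 ⟨le_rfl, h'.1⟩⟩,
      -- All output is present after one step, which is within real time because the input is
      -- nonempty.
      ⟨1, List.length_pos_iff.2 hw, (G.toCAT_emittedAt o hw _ _).2 ⟨le_rfl, h'.2⟩⟩⟩
  · ext ⟨w, v⟩
    exact G.mem_transduction_toCAT o w v

end LinearGrammar

/-! ### A linear grammar for the witness language -/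

/-- The words `& x_k & ⋯ & x_1 $ y_1 & ⋯ & y_k &` of the witness language, with `k = 0` allowed,
built from the inside to the outside. -/
inductive Nested : ℕ → List Letter → Prop
  | center : Nested 0 [Letter.dollar]
  | wrap {k u y z} : Nested k u → IsABWord y → IsABWord z →
      Nested (k + 1) ([Letter.amp] ++ z ++ y.reverse ++ u ++ y ++ [Letter.amp])

theorem IsABWord.append {u v : List Letter} (hu : IsABWord u) (hv : IsABWord v) :
    IsABWord (u ++ v) := by
  intro s hs
  rcases List.mem_append.1 hs with h | h
  exacts [hu s h, hv s h]

theorem IsABWord.reverse {u : List Letter} (hu : IsABWord u) : IsABWord u.reverse :=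
  fun s hs => hu s (List.mem_reverse.1 hs)

theorem isABWord_nil : IsABWord [] := by simp [IsABWord]

theorem isABWord_cons {c : Letter} {u : List Letter} :
    IsABWord (c :: u) ↔ (c = Letter.a ∨ c = Letter.b) ∧ IsABWord u := by
  simp [IsABWord]

/-- The word `& x_k & ⋯ & x_1 $ y_1 & ⋯ & y_k &`. -/
def nestedWord {k : ℕ} (x y : Fin k → List Letter) : List Letter :=
  (List.ofFn x).reverse.flatMap (fun u => [Letter.amp] ++ u) ++ [Letter.dollar] ++
    (List.ofFn y).flatMap (fun u => u ++ [Letter.amp])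

theorem nestedWord_succ {k : ℕ} (x y : Fin (k + 1) → List Letter) :
    nestedWord x y = [Letter.amp] ++ x (Fin.last k) ++
      nestedWord (fun i => x i.castSucc) (fun i => y i.castSucc) ++
      y (Fin.last k) ++ [Letter.amp] := by
  simp [nestedWord, List.ofFn_succ', -List.ofFn_succ]

theorem nested_nestedWord {k : ℕ} (x y z : Fin k → List Letter)
    (h : ∀ i, IsABWord (x i) ∧ IsABWord (y i) ∧ IsABWord (z i) ∧
      (x i).reverse = y i ++ z i) : Nested k (nestedWord x y) := by
  induction k with
  | zero => simpa [nestedWord] using Nested.center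
  | succ k ih =>
    obtain ⟨-, hy, hz, hr⟩ := h (Fin.last k)
    have hx : x (Fin.last k) = (z (Fin.last k)).reverse ++ (y (Fin.last k)).reverse := by
      rw [← List.reverse_append, ← hr, List.reverse_reverse]
    rw [nestedWord_succ, hx, ← List.append_assoc [Letter.amp]]
    exact .wrap (ih _ _ (fun i => z i.castSucc) fun i => h i.castSucc) hy hz.reverse

theorem Nested.exists_nestedWord {k : ℕ} {u : List Letter} (h : Nested k u) :
    ∃ x y z : Fin k → List Letter, (∀ i, IsABWord (x i) ∧ IsABWord (y i) ∧ IsABWord (z i) ∧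
      (x i).reverse = y i ++ z i) ∧ u = nestedWord x y := by
  induction h with
  | center => exact ⟨fun _ => [], fun _ => [], fun _ => [], fun i => i.elim0, rfl⟩
  | @wrap k u b c _ hb hc ih =>
    obtain ⟨x, y, z, hi, rfl⟩ := ih
    refine ⟨Fin.snoc (α := fun _ => List Letter) x (c ++ b.reverse),
      Fin.snoc (α := fun _ => List Letter) y b,
      Fin.snoc (α := fun _ => List Letter) z c.reverse, fun i => ?_, ?_⟩
    · refine Fin.lastCases ?_ (fun i => ?_) i
      · simpa using ⟨hc.append hb.reverse, hb, hc.reverse⟩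
      · simpa using hi i
    · simp [nestedWord_succ]

theorem mem_witnessLanguage_iff {w : List Letter} :
    w ∈ witnessLanguage ↔ ∃ k, Nested (k + 1) w := by
  constructor
  · rintro ⟨k, x, y, z, hk, h, rfl⟩
    obtain ⟨k, rfl⟩ := Nat.exists_eq_add_of_le' hk
    exact ⟨k, nested_nestedWord x y z h⟩
  · rintro ⟨k, h⟩
    obtain ⟨x, y, z, hi, rfl⟩ := h.exists_nestedWord
    exact ⟨k + 1, x, y, z, by omega, hi, rfl⟩

/-- The nonterminals of a linear grammar for the witness language. -/
inductive WitnessNT where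
  | outer
  | closing
  | pad
  | core
  | back (c : Letter)

theorem WitnessNT.finite : Finite WitnessNT := by
  refine Finite.of_surjective (α := Fin 4 ⊕ Letter)
    (Sum.elim ![.outer, .closing, .pad, .core] .back) ?_
  rintro (_ | _ | _ | _ | c)
  exacts [⟨.inl 0, rfl⟩, ⟨.inl 1, rfl⟩, ⟨.inl 2, rfl⟩, ⟨.inl 3, rfl⟩, ⟨.inr c, rfl⟩]

namespace WitnessNT

/-- The rules `X → c Y`. -/
inductive LeftRule : WitnessNT → Letter → WitnessNT → Prop
  | outer : LeftRule outer .amp closing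
  | pad {c} : c = Letter.a ∨ c = Letter.b → LeftRule pad c pad
  | pad_back {c} : c = Letter.a ∨ c = Letter.b → LeftRule pad c (back c)
  | core_back {c} : c = Letter.a ∨ c = Letter.b → LeftRule core c (back c)
  | pad_amp : LeftRule pad .amp closing
  | core_amp : LeftRule core .amp closing

/-- The rules `X → Y c`. -/
inductive RightRule : WitnessNT → WitnessNT → Letter → Prop
  | closing : RightRule closing pad .amp
  | back {c} : RightRule (back c) core c

/-- The rules `X → c`. -/
inductive TermRule : WitnessNT → Letter → Prop
  | pad : TermRule pad .dollar
  | core : TermRule core .dollar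

end WitnessNT

/-- A linear grammar for the witness language. -/
def witnessGrammar : LinearGrammar Letter where
  NT := WitnessNT
  finite_NT := WitnessNT.finite
  start := .outer
  left := WitnessNT.LeftRule
  right := WitnessNT.RightRule
  term := WitnessNT.TermRule

/-- A word `y^R u y` with `u` nested. -/
def IsCoreWord (w : List Letter) : Prop :=
  ∃ k u y, Nested k u ∧ IsABWord y ∧ w = y.reverse ++ u ++ y

/-- The words derived from the nonterminals of `witnessGrammar`. -/
def WitnessNT.Words : WitnessNT → List Letter → Prop
  | .outer, w => ∃ k, Nested (k + 1) w
  | .closing, w => ∃ k, Nested (k + 1) (Letter.amp :: w)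
  | .pad, w => ∃ z v, IsABWord z ∧ IsCoreWord v ∧ w = z ++ v
  | .core, w => IsCoreWord w
  | .back c, w => ∃ v, IsCoreWord v ∧ w = v ++ [c]

theorem Nested.isCoreWord {k : ℕ} {u : List Letter} (h : Nested k u) : IsCoreWord u :=
  ⟨k, u, [], h, isABWord_nil, by simp⟩

theorem IsCoreWord.pad {v : List Letter} (h : IsCoreWord v) : WitnessNT.pad.Words v :=
  ⟨[], v, isABWord_nil, h, rfl⟩

theorem IsCoreWord.extend {c : Letter} (hc : c = Letter.a ∨ c = Letter.b) {v : List Letter}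
    (h : IsCoreWord v) : IsCoreWord (c :: (v ++ [c])) := by
  obtain ⟨k, u, y, hu, hy, rfl⟩ := h
  exact ⟨k, u, y ++ [c], hu, hy.append (isABWord_cons.2 ⟨hc, isABWord_nil⟩), by simp⟩

/-- `pad` consumes the unmatched letters of a block. Once `back` has started matching, only `core`
remains, so no further padding is possible before the next `&`. -/
theorem words_of_derives {X : witnessGrammar.NT} {w : List Letter}
    (h : witnessGrammar.Derives X w) : WitnessNT.Words X w := by
  induction h with
  | term h =>
    cases h with
    | pad => exact Nested.center.isCoreWord.pad
    | core => exact Nested.center.isCoreWord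
  | left h _ ih =>
    cases h with
    | outer => exact ih
    | pad hc =>
      obtain ⟨z, v, hz, hv, rfl⟩ := ih
      exact ⟨_ :: z, v, isABWord_cons.2 ⟨hc, hz⟩, hv, rfl⟩
    | pad_back hc =>
      obtain ⟨v, hv, rfl⟩ := ih
      exact (hv.extend hc).pad
    | core_back hc =>
      obtain ⟨v, hv, rfl⟩ := ih
      exact hv.extend hc
    | pad_amp =>
      obtain ⟨k, hk⟩ := ih
      exact hk.isCoreWord.pad
    | core_amp =>
      obtain ⟨k, hk⟩ := ih
      exact hk.isCoreWord
  | right h _ ih =>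
    cases h with
    | closing =>
      obtain ⟨z, v, hz, ⟨k, u, y, hu, hy, rfl⟩, rfl⟩ := ih
      exact ⟨k, by simpa using Nested.wrap hu hy hz⟩
    | back => exact ⟨_, ih, rfl⟩

theorem derives_core_extend {u y : List Letter} (hu : witnessGrammar.Derives .core u)
    (hy : IsABWord y) : witnessGrammar.Derives .core (y.reverse ++ u ++ y) := by
  -- The last letter of `y` is the outermost one, hence matched by the first rules of the
  -- derivation.
  induction y using List.reverseRecOn with
  | nil => simpa using hu
  | append_singleton y c ih =>
    have hc := hy c (by simp)
    have := ih fun s hs => hy s (by simp [hs])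
    have e : (y ++ [c]).reverse ++ u ++ (y ++ [c]) = c :: ((y.reverse ++ u ++ y) ++ [c]) := by
      simp
    rw [e]
    exact .left (WitnessNT.LeftRule.core_back hc) (.right WitnessNT.RightRule.back this)

/-- Every rule of `core` has a counterpart for `pad` with the same right-hand side. -/
theorem derives_pad_of_core {u : List Letter} (h : witnessGrammar.Derives .core u) :
    witnessGrammar.Derives .pad u := by
  have key : ∀ X : witnessGrammar.NT, witnessGrammar.Derives X u → X = WitnessNT.core →
      witnessGrammar.Derives WitnessNT.pad u := by
    intro X h hX
    cases h with
    | term h => subst hX; cases h; exact .term WitnessNT.TermRule.pad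
    | left h h' =>
      subst hX
      cases h with
      | core_back hc => exact .left (WitnessNT.LeftRule.pad_back hc) h'
      | core_amp => exact .left WitnessNT.LeftRule.pad_amp h'
    | right h _ => subst hX; cases h
  exact key _ h rfl

theorem derives_pad_append {u z : List Letter} (h : witnessGrammar.Derives .pad u)
    (hz : IsABWord z) : witnessGrammar.Derives .pad (z ++ u) := by
  induction z with
  | nil => exact h
  | cons c z ih =>
    obtain ⟨hc, hz⟩ := isABWord_cons.1 hz
    exact .left (WitnessNT.LeftRule.pad hc) (ih hz)

theorem derives_closing {u y z : List Letter} (hu : witnessGrammar.Derives .core u)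
    (hy : IsABWord y) (hz : IsABWord z) :
    witnessGrammar.Derives .closing (z ++ y.reverse ++ u ++ y ++ [Letter.amp]) := by
  have := derives_pad_append (derives_pad_of_core (derives_core_extend hu hy)) hz
  simp only [← List.append_assoc] at this
  exact .right WitnessNT.RightRule.closing this

theorem Nested.derives_core {k : ℕ} {u : List Letter} (h : Nested k u) :
    witnessGrammar.Derives .core u := by
  induction h with
  | center => exact .term WitnessNT.TermRule.core
  | wrap _ hy hz ih => exact .left WitnessNT.LeftRule.core_amp (derives_closing ih hy hz)

theorem witnessGrammar_lang : witnessGrammar.lang = witnessLanguage := by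
  ext w
  rw [mem_witnessLanguage_iff]
  refine ⟨fun h => words_of_derives h, ?_⟩
  rintro ⟨k, h⟩
  cases h with
  | wrap hu hy hz => exact .left WitnessNT.LeftRule.outer (derives_closing hu.derives_core hy hz)

/-! ### Unique decomposition and the bit-vector words -/

theorem append_cons_inj {α : Type*} {c : α} {u u' v v' : List α} (hu : c ∉ u) (hu' : c ∉ u')
    (h : u ++ c :: v = u' ++ c :: v') : u = u' ∧ v = v' := by
  induction u generalizing u' with
  | nil =>
    cases u' with
    | nil => exact ⟨rfl, (List.cons.inj h).2⟩
    | cons d' u' => exact absurd (List.cons.inj h).1 (by simp_all)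
  | cons d u ih =>
    cases u' with
    | nil => exact absurd (List.cons.inj h).1 (by simp_all [eq_comm])
    | cons d' u' =>
      simp only [List.mem_cons, not_or] at hu hu'
      obtain ⟨rfl, h'⟩ := List.cons.inj h
      obtain ⟨rfl, rfl⟩ := ih hu.2 hu'.2 h'
      exact ⟨rfl, rfl⟩

theorem flatMap_amp_injective {l l' : List (List Letter)} (hl : ∀ u ∈ l, IsABWord u)
    (hl' : ∀ u ∈ l', IsABWord u)
    (h : l.flatMap (fun u => u ++ [Letter.amp]) = l'.flatMap (fun u => u ++ [Letter.amp])) :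
    l = l' := by
  have amp_notMem : ∀ u, IsABWord u → Letter.amp ∉ u := fun u hu hm => by
    simpa using hu _ hm
  induction l generalizing l' with
  | nil =>
    cases l' with
    | nil => rfl
    | cons u l' => simp at h
  | cons u l ih =>
    cases l' with
    | nil => simp at h
    | cons u' l' =>
      simp only [List.forall_mem_cons] at hl hl'
      simp only [List.flatMap_cons, List.append_assoc, List.singleton_append] at h
      obtain ⟨rfl, h'⟩ := append_cons_inj (amp_notMem _ hl.1) (amp_notMem _ hl'.1) h
      rw [ih hl.2 hl'.2 h']

/-- The blocks contain neither `$` nor `&`. The word therefore splits uniquely at `$`; its right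
part is a sequence of blocks ended by `&`, and so is the reversal of its left part. -/
theorem nestedWord_injective {k : ℕ} {k' : ℕ} {x y : Fin k → List Letter}
    {x' y' : Fin k' → List Letter} (hx : ∀ i, IsABWord (x i)) (hy : ∀ i, IsABWord (y i))
    (hx' : ∀ i, IsABWord (x' i)) (hy' : ∀ i, IsABWord (y' i))
    (h : nestedWord x y = nestedWord x' y') :
    List.ofFn x = List.ofFn x' ∧ List.ofFn y = List.ofFn y' := by
  have dollar_notMem : ∀ {k : ℕ} {x : Fin k → List Letter}, (∀ i, IsABWord (x i)) →
      Letter.dollar ∉ (List.ofFn x).reverse.flatMap (fun u => [Letter.amp] ++ u) := by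
    intro k x hx hm
    obtain ⟨u, hu, hm⟩ := List.mem_flatMap.1 hm
    obtain ⟨i, rfl⟩ := List.mem_ofFn.1 (List.mem_reverse.1 hu)
    simp only [List.singleton_append, List.mem_cons, reduceCtorEq, false_or] at hm
    simpa using hx i _ hm
  have reverse_eq : ∀ {k : ℕ} (x : Fin k → List Letter),
      ((List.ofFn x).reverse.flatMap (fun u => [Letter.amp] ++ u)).reverse =
        ((List.ofFn x).map List.reverse).flatMap (fun u => u ++ [Letter.amp]) := by
    intro k x
    rw [List.reverse_flatMap, List.reverse_reverse, List.flatMap_map]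
    simp [Function.comp_def]
  have ab : ∀ {k : ℕ} {x : Fin k → List Letter}, (∀ i, IsABWord (x i)) →
      ∀ u ∈ List.ofFn x, IsABWord u := by
    intro k x hx u hu
    obtain ⟨i, rfl⟩ := List.mem_ofFn.1 hu
    exact hx i
  have ab' : ∀ {k : ℕ} {x : Fin k → List Letter}, (∀ i, IsABWord (x i)) →
      ∀ u ∈ (List.ofFn x).map List.reverse, IsABWord u := by
    intro k x hx u hu
    obtain ⟨v, hv, rfl⟩ := List.mem_map.1 hu
    exact (ab hx v hv).reverse
  rw [nestedWord, nestedWord, List.append_assoc, List.append_assoc] at h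
  obtain ⟨h1, h2⟩ := append_cons_inj (dollar_notMem hx) (dollar_notMem hx') h
  refine ⟨?_, flatMap_amp_injective (ab hy) (ab hy') h2⟩
  have h3 := congrArg List.reverse h1
  rw [← List.map_injective_iff.2 List.reverse_injective |>.eq_iff]
  refine flatMap_amp_injective (ab' hx) (ab' hx') ?_
  rw [← reverse_eq, ← reverse_eq]
  exact h3

theorem nestedWord_mem_iff {k : ℕ} (hk : 1 ≤ k) {x y : Fin k → List Letter}
    (hx : ∀ i, IsABWord (x i)) (hy : ∀ i, IsABWord (y i)) :
    nestedWord x y ∈ witnessLanguage ↔ ∀ i, y i <+: (x i).reverse := by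
  constructor
  · rintro ⟨k', x', y', z, -, h, e⟩
    obtain ⟨e1, e2⟩ := nestedWord_injective hx hy (fun i => (h i).1) (fun i => (h i).2.1) e
    obtain rfl : k = k' := by simpa using congrArg List.length e1
    obtain rfl := List.ofFn_injective e1
    obtain rfl := List.ofFn_injective e2
    exact fun i => ⟨z i, (h i).2.2.2.symm⟩
  · intro h
    choose z hz using h
    refine ⟨k, x, y, z, hk, fun i => ⟨hx i, hy i, fun s hs => ?_, (hz i).symm⟩, rfl⟩
    exact (hx i).reverse s (by rw [← hz i]; simp [hs])

/-- Encoding of a bit vector as a word over `{a, b}`. -/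
def bitWord {k : ℕ} (v : Fin k → Bool) : List Letter :=
  List.ofFn fun i => if v i then Letter.a else Letter.b

theorem isABWord_bitWord {k : ℕ} (v : Fin k → Bool) : IsABWord (bitWord v) := by
  intro s hs
  obtain ⟨i, rfl⟩ := List.mem_ofFn.1 hs
  split <;> simp

theorem bitWord_injective {k : ℕ} : Function.Injective (bitWord (k := k)) := by
  intro v v' h
  ext i
  have := congrFun (List.ofFn_injective h) i
  cases h1 : v i <;> cases h2 : v' i <;> simp_all

theorem length_bitWord {k : ℕ} (v : Fin k → Bool) : (bitWord v).length = k := by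
  simp [bitWord]

/-- The word `& x_k & ⋯ & x_1 $` for bit vectors `x_i`. -/
def bitPrefix {k : ℕ} (x : Fin k → Fin k → Bool) : List Letter :=
  (List.ofFn fun i => bitWord (x i)).reverse.flatMap (fun u => [Letter.amp] ++ u) ++
    [Letter.dollar]

/-- The word `&^{i-1} v^R &^{k-i+1}` for a bit vector `v`. -/
def bitSuffix {k : ℕ} (i : Fin k) (v : Fin k → Bool) : List Letter :=
  (List.ofFn fun j => if j = i then (bitWord v).reverse else []).flatMap
    (fun u => u ++ [Letter.amp])

theorem length_bitSuffix {k : ℕ} (i : Fin k) (v : Fin k → Bool) :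
    (bitSuffix i v).length = 2 * k := by
  simp only [bitSuffix, List.length_flatMap, List.map_ofFn, List.sum_ofFn, Function.comp_def,
    List.length_append, List.length_singleton, Finset.sum_add_distrib, apply_ite List.length,
    List.length_reverse, length_bitWord, List.length_nil]
  simp
  omega

/-- Empty blocks are prefixes of everything, so only block `i` imposes a condition; there a prefix
of full length is the whole word. -/
theorem bitPrefix_append_bitSuffix_mem {k : ℕ} (x : Fin k → Fin k → Bool) (i : Fin k)
    (v : Fin k → Bool) : bitPrefix x ++ bitSuffix i v ∈ witnessLanguage ↔ x i = v := by
  have hk : 1 ≤ k := i.pos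
  refine (nestedWord_mem_iff hk (fun j => isABWord_bitWord (x j)) fun j => ?_).trans ?_
  · split
    exacts [(isABWord_bitWord v).reverse, isABWord_nil]
  · constructor
    · intro h
      have h1 := h i
      rw [if_pos rfl] at h1
      have h2 := h1.eq_of_length (by simp [length_bitWord])
      exact (bitWord_injective (List.reverse_injective h2)).symm
    · rintro rfl j
      split
      · next h => rw [h]
      · exact List.nil_prefix

/-! ### The counting bound for real-time iterative arrays -/

namespace IAT

variable {A B : Type} (M : IAT A B)

theorem config_congr {w w' : List A} {t : ℕ} (h : ∀ s < t, w[s]? = w'[s]?) :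
    M.config w t = M.config w' t := by
  induction t with
  | zero => rfl
  | succ t ih =>
    rw [config, config, ih fun s hs => h s (by omega), h t (by omega)]

/-- The states of the cells `0, …, r`, or `none` if the array has halted. -/
def window (r : ℕ) (c : Option M.Config) : Option (Fin (r + 1) → M.State) :=
  c.map fun c i => c.cell i

variable {M} in
theorem window_some_eq {r : ℕ} {c c' : M.Config} :
    M.window r (some c) = M.window r (some c') ↔ ∀ i ≤ r, c.cell i = c'.cell i := by
  simp only [window, Option.map_some, Option.some.injEq, funext_iff, Fin.forall_iff]
  exact forall_congr' fun i => by rw [Nat.lt_succ_iff]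

/-- Information travels one cell per step, so one cell of the window is lost. Halting depends only
on the input symbol and on cells `0` and `1`, which are inside the larger window. -/
theorem window_step {r : ℕ} {c c' : Option M.Config}
    (h : M.window (r + 1) c = M.window (r + 1) c') (x : Option A) :
    M.window r (c.bind (M.step x)) = M.window r (c'.bind (M.step x)) := by
  cases c with
  | none => cases c' with
    | none => rfl
    | some c' => simp [window] at h
  | some c => cases c' with
    | none => simp [window] at h
    | some c' =>
      have h := window_some_eq.1 h
      simp only [Option.bind_some, step]
      rw [h 0 (by omega), h 1 (by omega)]
      cases M.δ₀ x (c'.cell 0) (c'.cell 1) with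
      | none => rfl
      | some p =>
        simp only [Option.map_some]
        refine window_some_eq.2 fun i hi => ?_
        cases i with
        | zero => rfl
        | succ i => simp only [h i (by omega), h (i + 1) (by omega), h (i + 2) (by omega)]

theorem window_config {p p' u : List A} {r : ℕ}
    (h : M.window r (M.config p p.length) = M.window r (M.config p' p'.length)) {s t : ℕ}
    (hst : s + t = r) : M.window s (M.config (p ++ u) (p.length + t)) =
      M.window s (M.config (p' ++ u) (p'.length + t)) := by
  induction t generalizing s with
  | zero =>
    obtain rfl : s = r := hst
    simp only [Nat.add_zero, Nat.add_zero,
      M.config_congr (w := p ++ u) (w' := p) fun s hs => List.getElem?_append_left hs,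
      M.config_congr (w := p' ++ u) (w' := p') fun s hs => List.getElem?_append_left hs, h]
  | succ t ih =>
    rw [← Nat.add_assoc, ← Nat.add_assoc, config, config,
      List.getElem?_append_right (by omega), List.getElem?_append_right (by omega),
      Nat.add_sub_cancel_left, Nat.add_sub_cancel_left]
    exact M.window_step (ih (by omega)) _

/-- The information about the computation on `p` that determines real-time acceptance of all
extensions of `p` by `r - 1` symbols. -/
def signature (r : ℕ) (p : List A) : Prop × Option (Fin (r + 1) → M.State) :=
  (∃ t ≤ p.length, M.AcceptsAt p t, M.window r (M.config p p.length))

/-- An accepting time within the prefix is covered by the first component of the signature. A later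
one lies at most `u.length + 1` steps after the prefix, so a window of that radius still determines
cell `0`. -/
theorem accepts_of_signature_eq {p p' u : List A}
    (h : M.signature (u.length + 1) p = M.signature (u.length + 1) p') {t : ℕ}
    (ht : t ≤ rtIA (p ++ u).length) (ha : M.AcceptsAt (p ++ u) t) : M.Accepts (p' ++ u) := by
  obtain ⟨h1, h2⟩ := Prod.mk.inj h
  simp only [rtIA, List.length_append] at ht
  have hcfg : ∀ q : List A, ∀ t ≤ q.length, M.config (q ++ u) t = M.config q t := fun q t ht =>
    M.config_congr fun s hs => List.getElem?_append_left (by omega)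
  rcases Nat.le_total t p.length with htp | htp
  · have : ∃ t ≤ p.length, M.AcceptsAt p t := ⟨t, htp, by
      rwa [AcceptsAt, hcfg p t htp] at ha⟩
    rw [h1] at this
    obtain ⟨t', ht', ha'⟩ := this
    exact ⟨t', by rwa [AcceptsAt, hcfg p' t' ht']⟩
  · obtain ⟨s, rfl⟩ := Nat.exists_eq_add_of_le htp
    have hw := M.window_config h2 (u := u) (s := u.length + 1 - s) (t := s) (by omega)
    obtain ⟨c, hc, hF⟩ := ha
    refine ⟨p'.length + s, ?_⟩
    rw [hc] at hw
    cases hc' : M.config (p' ++ u) (p'.length + s) with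
    | none => simp [hc', window] at hw
    | some c' =>
      rw [hc'] at hw
      exact ⟨c', hc', by rwa [← window_some_eq.1 hw 0 (Nat.zero_le _)]⟩

theorem not_realTime_witnessLanguage {B : Type} (M : IAT Letter B) :
    ¬ ∀ w : List Letter, w ≠ [] → ((M.Accepts w ↔ w ∈ witnessLanguage) ∧
      (M.Accepts w → ∃ t ≤ rtIA w.length, M.AcceptsAt w t)) := by
  intro hM
  have := M.finite_state
  have hinj : ∀ k, Function.Injective fun x : Fin k → Fin k → Bool =>
      M.signature (2 * k + 1) (bitPrefix x) := by
    intro k x x' h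
    ext1 i
    have hne : ∀ x'' : Fin k → Fin k → Bool, bitPrefix x'' ++ bitSuffix i (x i) ≠ [] := fun x'' => by simp [bitPrefix]
    have h1 := (bitPrefix_append_bitSuffix_mem x i (x i)).2 rfl
    have h2 := hM _ (hne x)
    obtain ⟨t, ht, ha⟩ := h2.2 (h2.1.2 h1)
    have h3 := M.accepts_of_signature_eq (p' := bitPrefix x')
      (by rw [length_bitSuffix]; exact h) ht ha
    exact ((bitPrefix_append_bitSuffix_mem x' i (x i)).1 ((hM _ (hne x')).1.1 h3)).symm
  -- The window for `r = 2 * k + 1` has `2 * k + 2` cells; the summand `1` stands for a halted array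
  -- and the factor `2` for the proposition in the signature.
  have hcard : ∀ k, 2 ^ (k * k) ≤ 2 * (Nat.card M.State ^ (2 * k + 2) + 1) := by
    intro k
    have := Nat.card_le_card_of_injective _ (hinj k)
    simpa [Nat.card_prod, Nat.card_fun, Finite.card_option, pow_mul] using this
  set q := Nat.card M.State
  -- With `k = 2 * q + 3`, the exponent `k * k = 4 * q ^ 2 + 12 * q + 9` exceeds `q * (2 * k + 2) +
  -- 2 = 4 * q ^ 2 + 8 * q + 2`.
  have h1 := hcard (2 * q + 3)
  have h2 : q ^ (2 * (2 * q + 3) + 2) ≤ 2 ^ (q * (2 * (2 * q + 3) + 2)) := by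
    rw [pow_mul]
    exact Nat.pow_le_pow_left Nat.lt_two_pow_self.le _
  have h3 : 2 ^ (q * (2 * (2 * q + 3) + 2) + 2) < 2 ^ ((2 * q + 3) * (2 * q + 3)) :=
    Nat.pow_lt_pow_right (by omega) (by ring_nf; omega)
  have h4 := Nat.one_le_two_pow (n := q * (2 * (2 * q + 3) + 2))
  rw [pow_add] at h3
  omega

end IAT

theorem mainTheorem6 :
    IsLinearContextFree witnessLanguage ∧
    ¬ AcceptedByIA rtIA witnessLanguage ∧
    ∀ tout : ℕ → ℕ, (∀ n, n ≤ tout n) →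
      unaryTransduction witnessLanguage ∈ CAT.family Letter Letter rtCAT rtCAT ∧
      unaryTransduction witnessLanguage ∉ IAT.family Letter Letter rtIA tout := by
  refine ⟨?_, fun ⟨M, hM⟩ => M.not_realTime_witnessLanguage hM, fun tout _ => ⟨?_, ?_⟩⟩
  · rw [← witnessGrammar_lang]
    exact witnessGrammar.isLinearContextFree
  · rw [← witnessGrammar_lang]
    exact witnessGrammar.unary_mem_family Letter.a
  · rintro ⟨M, hdom, htime, hT⟩
    -- Since acceptance determines the domain, the transducer is itself a real-time acceptor of the
    -- language.
    refine M.not_realTime_witnessLanguage fun w hw => ⟨?_, fun ha => ?_⟩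
    · rw [hdom w hw, hT]
      exact ⟨fun ⟨v, hv⟩ => hv.1, fun h => ⟨List.replicate w.length Letter.a, h, rfl⟩⟩
    · obtain ⟨v, hv⟩ := (hdom w hw).1 ha
      exact (htime w v hv).1
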